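/- All graphs are finite, simple and undirected; a graph class is a set of graphs; structures are relational structures, considered up to isomorphism. The treedepth of a graph $G$ is the minimum depth of a rooted forest on the vertex set $V(G)$ such that the endpoints of every edge of $G$ are in the ancestor/descendant relation, where the depth of a rooted forest is the maximum number of vertices on a root-to-leaf path (and $0$ for the empty forest). A class $\mathscr{C}$ has bounded treedepth if there is $c\in\mathbb{N}$ such that every $G\in\mathscr{C}$ has treedepth at most $c$. The incidence encoding of $G$ is the structure with universe $V(G)\sqcup E(G)$, two unary predicates selecting the vertices and the edges, respectively, and a binary predicate $\mathsf{inc}$ such that $\mathsf{inc}(u,e)$ holds iff $u$ is a vertex, $e$ is an edge, and $u$ is an endpoint of $e$. A finite rooted tree is viewed as a structure over the signature consisting of one binary predicate, interpreted as the ancestor relation (every node being an ancestor of itself). A (first-order) transduction $\mathsf{T}$ from $\Sigma$-structures to $\Gamma$-structures consists of a finite set $C$ of colors (new unary predicates) and, for each $R\in\Gamma$, a first-order formula $\varphi_R(x_1,\ldots,x_{\mathrm{arity}(R)})$ over the signature $\Sigma\cup C$. The outputs of $\mathsf{T}$ on a $\Sigma$-structure $\mathbb{A}$ are all structures obtained by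 expanding $\mathbb{A}$ with an arbitrary interpretation of the colors as subsets of the universe, forming the $\Gamma$-structure on the same universe in which each $R$ is the relation defined by $\varphi_R$, and taking an arbitrary (possibly empty) induced substructure. A class $\mathscr{B}$ of $\Gamma$-structures can be transduced from a class $\mathscr{A}$ of $\Sigma$-structures if there is one transduction $\mathsf{T}$ such that every structure in $\mathscr{B}$ is an output of $\mathsf{T}$ on some structure in $\mathscr{A}$. Theorem. A graph class $\mathscr{C}$ has bounded treedepth if and only if there are $d\in\mathbb{N}$ and a class $\mathscr{T}$ of finite rooted trees of depth at most $d$ such that the class of incidence encodings of graphs from $\mathscr{C}$ can be transduced from $\mathscr{T}$. -/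

import Mathlib

universe u

/-! ### Treedepth -/

/-- A finite simple undirected graph. A graph class is a set of such graphs. -/
structure FinGraph where
  V : Type u
  [finite : Finite V]
  graph : SimpleGraph V

/-- A rooted forest with vertex set `V`, given by its ancestor order: `le u v` means that `u` is an
ancestor of `v` (every vertex is an ancestor of itself). The ancestors of each vertex form a chain.
For finite `V` these orders are exactly the ancestor orders of rooted forests: the roots are
the minimal elements, and the parent of a non-root `v` is the largest proper ancestor of `v`. -/
structure RootedForest (V : Type u) where
  order : PartialOrder V
  isChain_ancestors : ∀ v, IsChain order.le {w | order.le w v}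

/-- The depth of a finite rooted forest: the maximum number of vertices on a path from a root to a
vertex (equivalently, to a leaf); this path consists of the ancestors of its endpoint. -/
noncomputable def RootedForest.depth {V : Type u} (F : RootedForest V) : ℕ :=
  ⨆ v : V, {w | F.order.le w v}.ncard

/-- `F` is an elimination forest of `G`: the endpoints of every edge of `G` are in the
ancestor/descendant relation in `F`. -/
def RootedForest.IsEliminationForest {V : Type u} (F : RootedForest V) (G : SimpleGraph V) : Prop :=
  ∀ v w, G.Adj v w → F.order.le v w ∨ F.order.le w v

/-- The treedepth: the minimum depth of an elimination forest. -/
noncomputable def treedepth (G : FinGraph.{u}) : ℕ :=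
  sInf {d | ∃ F : RootedForest G.V, F.IsEliminationForest G.graph ∧ F.depth = d}

/-- The minimum in the definition of treedepth is attained. -/
theorem exists_eliminationForest_depth_eq_treedepth (G : FinGraph.{u}) :
    ∃ F : RootedForest G.V, F.IsEliminationForest G.graph ∧ F.depth = treedepth G := by
  refine Nat.sInf_mem (s := {d | ∃ F : RootedForest G.V,
    F.IsEliminationForest G.graph ∧ F.depth = d}) ?_
  let o : LinearOrder G.V := IsWellOrder.linearOrder WellOrderingRel
  exact ⟨_, ⟨o.toPartialOrder, fun v a _ b _ _ => o.le_total a b⟩, fun v w _ => o.le_total v w, rfl⟩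

/-- A graph class has bounded treedepth. -/
def HasBoundedTreedepth (𝒞 : Set FinGraph.{u}) : Prop :=
  ∃ c : ℕ, ∀ G ∈ 𝒞, treedepth G ≤ c

/-! ### First-order transductions between classes of relational structures -/

open FirstOrder CategoryTheory

/-- The predicates of a signature with one unary predicate for each color of `C`. -/
inductive ColorRel (C : Type) : ℕ → Type
  | color (c : C) : ColorRel C 1

/-- The signature with one unary predicate for each color of `C`. -/
def colorLanguage (C : Type) : FirstOrder.Language.{0, 0} := ⟨fun _ => Empty, ColorRel C⟩

/-- An arbitrary coloring (the colors need be neither disjoint nor exhaustive). -/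
@[reducible]
def coloringStructure {C : Type} {A : Type u} (col : C → Set A) :
    (colorLanguage C).Structure A where
  funMap f := nomatch f
  RelMap r x := match r, x with
    | .color c, x => x 0 ∈ col c

/-- A first-order transduction from `L`-structures to `L'`-structures: a finite set of colors and,
for each predicate of `L'` of arity `n`, a first-order formula with free variables `x₀, …, xₙ₋₁`
over the signature `L` extended by the colors. -/
structure Transduction (L L' : FirstOrder.Language.{0, 0}) where
  Color : Type
  [finite : Finite Color]
  formula : ∀ {n : ℕ}, L'.Relations n → (L.sum (colorLanguage Color)).Formula (Fin n)

/-- Coloring and interpretation: the `L'`-structure on the universe of `A` that the formulas define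
in the coloring `col` of `A`. -/
@[reducible]
def Transduction.interpret {L L' : FirstOrder.Language.{0, 0}} [L'.IsRelational] (T : Transduction L L')
    (A : Type u) [L.Structure A] (col : T.Color → Set A) : L'.Structure A where
  funMap f := isEmptyElim f
  RelMap r x :=
    letI := coloringStructure col
    (T.formula r).Realize x

/-- `B` is an output of the transduction `T` on `A`: for some coloring of `A`, the structure `B` is
(isomorphic to) an induced substructure of the interpreted structure. -/
def Transduction.IsOutput {L L' : FirstOrder.Language.{0, 0}} [L'.IsRelational] (T : Transduction L L')
    (A : Bundled.{u} L.Structure) (B : Bundled.{u} L'.Structure) : Prop :=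
  ∃ col : T.Color → Set A,
    letI := T.interpret A col
    ∃ S : L'.Substructure A, Nonempty (B ≃[L'] S)

/-- The class `𝒜` transduces the class `ℬ`. -/
def Transduces {L L' : FirstOrder.Language.{0, 0}} [L'.IsRelational]
    (𝒜 : Set (Bundled.{u} L.Structure)) (ℬ : Set (Bundled.{u} L'.Structure)) : Prop :=
  ∃ T : Transduction L L', ∀ B ∈ ℬ, ∃ A ∈ 𝒜, T.IsOutput A B

/-! ### Incidence encodings of graphs -/

/-- The predicates of incidence encodings: two unary ones selecting the vertices and the edges,
and the binary incidence predicate. -/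
inductive IncidenceRel : ℕ → Type
  | vertex : IncidenceRel 1
  | edge : IncidenceRel 1
  | inc : IncidenceRel 2

/-- The signature of incidence encodings. -/
def incidenceLanguage : FirstOrder.Language.{0, 0} := ⟨fun _ => Empty, IncidenceRel⟩

instance : incidenceLanguage.IsRelational := fun _ => inferInstanceAs (IsEmpty Empty)

/-- The incidence encoding of a graph. Its universe consists of the vertices and the edges. -/
def incidenceEncoding (G : FinGraph.{u}) : Bundled.{u} incidenceLanguage.Structure where
  α := G.V ⊕ G.graph.edgeSet
  str :=
    { funMap := fun f => nomatch f
      RelMap := fun r x => match r, x with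
        | .vertex, x => ∃ v : G.V, x 0 = Sum.inl v
        | .edge, x => ∃ e : G.graph.edgeSet, x 0 = Sum.inr e
        | .inc, x => ∃ (v : G.V) (e : G.graph.edgeSet),
            x 0 = Sum.inl v ∧ x 1 = Sum.inr e ∧ v ∈ e.1 }

/-! ### Rooted trees -/

/-- A rooted tree as a structure over the signature of one binary relation, the ancestor
relation: `x ≤ y` iff `x` is an ancestor of `y`, or `x = y`. -/
def treeEncoding (T : RootedTree.{u}) : Bundled.{u} Language.order.Structure where
  α := T
  str := FirstOrder.Language.orderStructure T

/-- The depth of a finite rooted tree: the maximum number of nodes on a path from the root to a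
node (equivalently, to a leaf). -/
noncomputable def treeDepth (T : RootedTree.{u}) : ℕ :=
  ⨆ v : T, (Set.Iic v).ncard

/-- A class of finite rooted trees of bounded depth. -/
def IsBoundedDepthTreeClass (𝒯 : Set RootedTree.{u}) : Prop :=
  (∀ T ∈ 𝒯, Finite T) ∧ ∃ d : ℕ, ∀ T ∈ 𝒯, treeDepth T ≤ d

/-! From bounded treedepth to trees: every edge of the graph is hung as a leaf below its lower
endpoint in an elimination forest of depth at most `c`, and a common root is added. Vertices are
coloured by their level, edges by the levels of both endpoints. The ancestors of an edge form a
chain, so a vertex among them is known from its level, and the endpoints of an edge are exactly its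
ancestor vertices that share a level colour with it.

From trees to bounded treedepth: incidence describes the 1-subdivision of the graph, in which every
path of the graph, induced or not, becomes an induced path. A graph whose paths have at most `k`
vertices has treedepth at most `k` (`treedepth_le_of_forall_path_length_le`). So it suffices that a
first-order definable relation on coloured trees of depth `d` has no long induced path
(`exists_bound_isInducedPath`).

This bound rests on a composition argument in the style of Feferman and Vaught. A tree of depth `d`
falls apart into single nodes in `d` rounds of splitting, where each round groups the nodes by their
ancestors up to the next level; the order between different groups depends on levels only. Hence the
type of a pair from two different parts depends only on the types of its two elements in their own
parts (`tupleType_pair_eq_of_separated`). By induction, an induced path cannot stay in one part for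
long, so a long one crosses between parts many times. Among many crossings some three look alike,
and exchanging their endpoints creates an adjacency that an induced path does not have.

Restrictions to parts keep the whole carrier and merely erase the colours of the other elements, so
that tuples never have to move between universes. -/

/-! ### Types of tuples in structures with coloured pairs -/

/-- The possible types of quantifier rank `q` of tuples indexed by `ι` in a structure whose pairs
of elements are coloured by `K`. -/
def TupleType (K : Type) : ℕ → Type → Type
  | 0, ι => ι → ι → K
  | q + 1, ι => Set (TupleType K q (Option ι))

theorem TupleType.finite (K : Type) [Finite K] (q : ℕ) (ι : Type) [Finite ι] :
    Finite (TupleType K q ι) := by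
  induction q generalizing ι with
  | zero => exact inferInstanceAs (Finite (ι → ι → K))
  | succ q ih =>
    have := ih (Option ι)
    exact inferInstanceAs (Finite (Set (TupleType K q (Option ι))))

/-- Extension of a tuple by an element. -/
def extendTuple {A : Type*} {ι : Type} (a : ι → A) (x : A) : Option ι → A
  | none => x
  | some i => a i

/-- The type of quantifier rank `q` of a tuple. -/
def tupleType {A : Type*} {K : Type} (c : A → A → K) :
    ∀ (q : ℕ) {ι : Type}, (ι → A) → TupleType K q ι
  | 0, _, a => fun i j => c (a i) (a j)
  | q + 1, _, a => Set.range fun x => tupleType c q (extendTuple a x)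

section TupleType

variable {A : Type*} {B : Type*} {K : Type} {c : A → A → K} {c' : B → B → K} {q : ℕ} {ι κ : Type}

theorem tupleType_zero_eq_iff {a : ι → A} {b : ι → B} :
    tupleType c 0 a = tupleType c' 0 b ↔ ∀ i j, c (a i) (a j) = c' (b i) (b j) := by
  change ((fun i j => c (a i) (a j)) = fun i j => c' (b i) (b j)) ↔ _
  simp only [funext_iff]

theorem tupleType_succ_eq_iff {a : ι → A} {b : ι → B} :
    tupleType c (q + 1) a = tupleType c' (q + 1) b ↔
      (∀ x, ∃ y, tupleType c q (extendTuple a x) = tupleType c' q (extendTuple b y)) ∧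
      ∀ y, ∃ x, tupleType c q (extendTuple a x) = tupleType c' q (extendTuple b y) := by
  change Set.range _ = Set.range _ ↔ _
  rw [Set.Subset.antisymm_iff, Set.range_subset_iff, Set.range_subset_iff]
  simp only [Set.mem_range, eq_comm]

theorem extendTuple_comp (a : ι → A) (g : κ → ι) (x : A) :
    extendTuple (a ∘ g) x = extendTuple a x ∘ Option.map g := by
  funext o
  cases o <;> rfl

theorem pair_eq_extendTuple (x y : A) :
    ![x, y] = extendTuple (fun _ : Unit => x) y ∘ ![some (), none] := by
  funext i
  fin_cases i <;> rfl

theorem tupleType_comp_eq {a : ι → A} {b : ι → B} (h : tupleType c q a = tupleType c' q b)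
    (g : κ → ι) : tupleType c q (a ∘ g) = tupleType c' q (b ∘ g) := by
  induction q generalizing ι κ with
  | zero =>
    rw [tupleType_zero_eq_iff] at h ⊢
    exact fun i j => h _ _
  | succ q ih =>
    rw [tupleType_succ_eq_iff] at h ⊢
    simp only [extendTuple_comp]
    exact ⟨fun x => (h.1 x).imp fun _ hy => ih hy _, fun y => (h.2 y).imp fun _ hx => ih hx _⟩

theorem tupleType_eq_of_succ [Nonempty A] {a : ι → A} {b : ι → B}
    (h : tupleType c (q + 1) a = tupleType c' (q + 1) b) : tupleType c q a = tupleType c' q b := by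
  obtain ⟨y, hy⟩ := (tupleType_succ_eq_iff.1 h).1 (Classical.arbitrary A)
  exact tupleType_comp_eq hy some

theorem tupleType_eq_of_le [Nonempty A] {q' : ℕ} (hq : q' ≤ q) {a : ι → A} {b : ι → B}
    (h : tupleType c q a = tupleType c' q b) : tupleType c q' a = tupleType c' q' b := by
  induction q, hq using Nat.le_induction with
  | base => exact h
  | succ n _ ih => exact ih (tupleType_eq_of_succ h)

theorem color_eq_of_tupleType_eq [Nonempty A] {a : ι → A} {b : ι → B}
    (h : tupleType c q a = tupleType c' q b) (i j : ι) : c (a i) (a j) = c' (b i) (b j) :=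
  tupleType_zero_eq_iff.1 (tupleType_eq_of_le (Nat.zero_le q) h) i j

/-- Twins cannot be told apart by any later move, so both tuples can be answered with the same
element. The main twins in use are uncoloured elements. -/
theorem tupleType_eq_of_twins {a b : ι → A}
    (h : ∀ i, c (a i) = c (b i) ∧ ∀ z, c z (a i) = c z (b i)) :
    tupleType c q a = tupleType c q b := by
  induction q generalizing ι with
  | zero =>
    rw [tupleType_zero_eq_iff]
    intro i j
    rw [(h i).1, (h j).2]
  | succ q ih =>
    have key (x : A) : tupleType c q (extendTuple a x) = tupleType c q (extendTuple b x) := by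
      refine ih fun o => ?_
      cases o with
      | none => exact ⟨rfl, fun _ => rfl⟩
      | some i => exact h i
    exact tupleType_succ_eq_iff.2 ⟨fun x => ⟨x, key x⟩, fun x => ⟨x, key x⟩⟩

end TupleType

/-! ### Partial structures and the composition of types -/

/-- The elements outside of the universe of a partial structure are those with `c x x = none`;
they carry no colours at all. -/
def IsPartialColoring {A : Type*} {K : Type} (c : A → A → Option K) : Prop :=
  ∀ x, c x x = none → ∀ z, c x z = none ∧ c z x = none

open Classical in
/-- The restriction to a part of a partition. -/
noncomputable def restrictColoring {A P : Type*} {K : Type} (c : A → A → Option K) (π : A → P)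
    (p : P) (x y : A) : Option K :=
  if π x = p ∧ π y = p then c x y else none

/-- The colour of a pair with elements in different parts is determined by the parts. -/
def IsSeparating {A P : Type*} {K : Type} (c : A → A → Option K) (π : A → P) : Prop :=
  ∃ F : Option K → Option K → Option K, ∀ x y, c x x ≠ none → c y y ≠ none → π x ≠ π y →
    c x y = F (c x x) (c y y)

section Composition

variable {A P : Type*} {K : Type} {c : A → A → Option K} {π : A → P} {p : P} {q : ℕ} {ι : Type}

theorem restrictColoring_self_eq_none {x : A} :
    restrictColoring c π p x x = none ↔ π x = p → c x x = none := by
  unfold restrictColoring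
  split_ifs with h <;> simp_all

theorem restrictColoring_of_eq {x y : A} (hx : π x = p) (hy : π y = p) :
    restrictColoring c π p x y = c x y := if_pos ⟨hx, hy⟩

theorem IsPartialColoring.restrict (hc : IsPartialColoring c) (π : A → P) (p : P) :
    IsPartialColoring (restrictColoring c π p) := by
  intro x hx z
  rw [restrictColoring_self_eq_none] at hx
  unfold restrictColoring
  constructor <;> split_ifs with h
  · exact (hc x (hx h.1) z).1
  · rfl
  · exact (hc x (hx h.2) z).2
  · rfl

theorem IsPartialColoring.tupleType_extend_congr (hc : IsPartialColoring c) {a b : ι → A} {x y : A}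
    (hab : ∀ i, a i = b i ∨ c (a i) (a i) = none ∧ c (b i) (b i) = none)
    (hxy : x = y ∨ c x x = none ∧ c y y = none) :
    tupleType c q (extendTuple a x) = tupleType c q (extendTuple b y) := by
  have key (x y : A) (h : x = y ∨ c x x = none ∧ c y y = none) :
      c x = c y ∧ ∀ z, c z x = c z y := by
    rcases h with rfl | ⟨h, h'⟩
    · exact ⟨rfl, fun _ => rfl⟩
    · refine ⟨?_, fun z => ((hc x h z).2.trans (hc y h' z).2.symm)⟩
      funext z
      exact (hc x h z).1.trans (hc y h' z).1.symm
  refine tupleType_eq_of_twins fun o => ?_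
  cases o with
  | none => exact key _ _ hxy
  | some i => exact key _ _ (hab i)

theorem IsPartialColoring.tupleType_extend_swap (hc : IsPartialColoring c) {b : ι → A} {y y' : A}
    (hy : c y y = none) (hy' : c y' y' = none) :
    tupleType c q (extendTuple b y) = tupleType c q (extendTuple b y') :=
  hc.tupleType_extend_congr (fun _ => .inl rfl) (.inr ⟨hy, hy'⟩)

/-- Elements outside of the universe can be added to tuples of the same type. -/
theorem tupleType_extend_of_succ {B : Type*} {c' : B → B → Option K} (hc' : IsPartialColoring c')
    {a : ι → A} {b : ι → B}
    (h : tupleType c (q + 1) a = tupleType c' (q + 1) b) {x : A} {y : B}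
    (hx : c x x = none) (hy : c' y y = none) :
    tupleType c q (extendTuple a x) = tupleType c' q (extendTuple b y) := by
  obtain ⟨y', hy'⟩ := (tupleType_succ_eq_iff.1 h).1 x
  have : Nonempty A := ⟨x⟩
  have h0 := color_eq_of_tupleType_eq hy' none none
  -- The partner `y'` of `x` has the same colour, so it is uncoloured as well, and uncoloured
  -- elements are interchangeable.
  exact hy'.trans (hc'.tupleType_extend_swap (h0.symm.trans hx) hy)

/-- One round of back-and-forth played in all parts at once: a move is a real move in only one part,
and in every other part it is an uncoloured element. -/
theorem tupleType_eq_of_parts_aux (hc : IsPartialColoring c) (σ : Equiv.Perm P)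
    {a b : ι → A} (h : ∀ p, tupleType (restrictColoring c π p) (q + 1) a =
      tupleType (restrictColoring c π (σ p)) (q + 1) b) (x : A) :
    ∃ y, ∀ p, tupleType (restrictColoring c π p) q (extendTuple a x) =
      tupleType (restrictColoring c π (σ p)) q (extendTuple b y) := by
  have : Nonempty A := ⟨x⟩
  by_cases hx : c x x = none
  · refine ⟨x, fun p => tupleType_extend_of_succ (hc.restrict π _) (h p) ?_ ?_⟩ <;>
    exact restrictColoring_self_eq_none.2 fun _ => hx
  obtain ⟨y, hy⟩ := (tupleType_succ_eq_iff.1 (h (π x))).1 x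
  have hxy := color_eq_of_tupleType_eq hy none none
  change restrictColoring c π (π x) x x = restrictColoring c π (σ (π x)) y y at hxy
  -- The answer is coloured in the part matched with that of `x`, so it lies in this part.
  have hyp : π y = σ (π x) := by
    by_contra hyp
    rw [restrictColoring_of_eq rfl rfl, restrictColoring_self_eq_none.2 (absurd · hyp)] at hxy
    exact hx hxy
  refine ⟨y, fun p => ?_⟩
  obtain rfl | hp := eq_or_ne (π x) p
  · exact hy
  · refine tupleType_extend_of_succ (hc.restrict π _) (h p) ?_ ?_ <;>
    rw [restrictColoring_self_eq_none]
    · exact (absurd · hp)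
    · exact fun h' => absurd (σ.injective (hyp.symm.trans h')) hp

/-- The types in the parts determine the type in the whole structure. -/
theorem tupleType_eq_of_parts (hc : IsPartialColoring c) (hπ : IsSeparating c π)
    (σ : Equiv.Perm P) {a b : ι → A} (h : ∀ p, tupleType (restrictColoring c π p) q a =
      tupleType (restrictColoring c π (σ p)) q b) : tupleType c q a = tupleType c q b := by
  induction q generalizing ι with
  | zero =>
    simp only [tupleType_zero_eq_iff] at h ⊢
    have hdiag (i : ι) : c (a i) (a i) = c (b i) (b i) ∧
        (c (a i) (a i) ≠ none → π (b i) = σ (π (a i))) := by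
      -- Two parts have to be compared: the second one excludes that `b i` is coloured in some other
      -- part while `a i` is uncoloured.
      have h1 := h (π (a i)) i i
      have h2 := h (σ.symm (π (b i))) i i
      rw [restrictColoring_of_eq rfl rfl] at h1
      rw [σ.apply_symm_apply, restrictColoring_of_eq (x := b i) rfl rfl] at h2
      unfold restrictColoring at h1 h2
      split_ifs at h1 with h3
      · exact ⟨h1, fun _ => h3.1⟩
      · refine ⟨?_, fun h4 => absurd h1 h4⟩
        rw [h1] at h2 ⊢
        split_ifs at h2 <;> exact h2
    intro i j
    by_cases hi : c (a i) (a i) = none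
    · rw [(hc _ hi _).1, (hc _ ((hdiag i).1.symm.trans hi) _).1]
    by_cases hj : c (a j) (a j) = none
    · rw [(hc _ hj _).2, (hc _ ((hdiag j).1.symm.trans hj) _).2]
    by_cases hij : π (a i) = π (a j)
    · have := h (π (a i)) i j
      rwa [restrictColoring_of_eq rfl hij.symm, restrictColoring_of_eq ((hdiag i).2 hi)
        (by rw [(hdiag j).2 hj, hij])] at this
    · obtain ⟨F, hF⟩ := hπ
      rw [hF _ _ hi hj hij, hF (b i) (b j), (hdiag i).1, (hdiag j).1]
      · rwa [← (hdiag i).1]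
      · rwa [← (hdiag j).1]
      · rw [(hdiag i).2 hi, (hdiag j).2 hj]
        exact fun h' => hij (σ.injective h')
  | succ q ih =>
    refine tupleType_succ_eq_iff.2 ⟨fun x => ?_, fun y => ?_⟩
    · obtain ⟨y, hy⟩ := tupleType_eq_of_parts_aux hc σ h x
      exact ⟨y, ih hy⟩
    · obtain ⟨x, hx⟩ := tupleType_eq_of_parts_aux hc σ.symm (a := b) (b := a) (fun p => by
        rw [h (σ.symm p), σ.apply_symm_apply]) y
      exact ⟨x, ih fun p => by rw [hx (σ p), σ.symm_apply_apply]⟩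

/-- A permutation with two prescribed values that preserves a function. -/
theorem exists_perm_apply_eq_apply_eq {T : Type*} (t : P → T) {p s p' s' : P} (hps : p ≠ s)
    (hps' : p' ≠ s') (hp : t p = t p') (hs : t s = t s') :
    ∃ σ : Equiv.Perm P, σ p = p' ∧ σ s = s' ∧ ∀ r, t (σ r) = t r := by
  classical
  have key (x y : P) (h : t x = t y) (r : P) : t (Equiv.swap x y r) = t r := by
    rw [Equiv.swap_apply_def]
    split_ifs with h1 h2
    · rw [h1, h]
    · rw [h2, h]
    · rfl
  have hs1 : t (Equiv.swap p p' s) = t s' := (key _ _ hp s).trans hs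
  refine ⟨(Equiv.swap p p').trans (Equiv.swap (Equiv.swap p p' s) s'), ?_, ?_, fun r => ?_⟩
  · rw [Equiv.trans_apply, Equiv.swap_apply_left, Equiv.swap_apply_of_ne_of_ne _ hps']
    intro h
    apply hps
    apply (Equiv.swap p p').injective
    rw [Equiv.swap_apply_left, ← h]
  · rw [Equiv.trans_apply, Equiv.swap_apply_left]
  · rw [Equiv.trans_apply, key _ _ hs1, key _ _ hp]

/-- The type of a pair with elements in different parts is determined by the types of its elements
in their parts. -/
theorem tupleType_pair_eq_of_separated (hc : IsPartialColoring c) (hπ : IsSeparating c π)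
    {x y x' y' : A} (hxy : π x ≠ π y) (hxy' : π x' ≠ π y')
    (hx : tupleType (restrictColoring c π (π x)) (q + 2) (fun _ : Unit => x) =
      tupleType (restrictColoring c π (π x')) (q + 2) (fun _ : Unit => x'))
    (hy : tupleType (restrictColoring c π (π y)) (q + 2) (fun _ : Unit => y) =
      tupleType (restrictColoring c π (π y')) (q + 2) (fun _ : Unit => y')) :
    tupleType c q ![x, y] = tupleType c q ![x', y'] := by
  have : Nonempty A := ⟨x⟩
  -- The parts of `x`, `y` go to those of `x'`, `y'`, and every part to one with the same type of
  -- the empty tuple. A part containing neither `x` nor `y` has to absorb two uncoloured elements,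
  -- each at the price of one rank; hence `q + 2`.
  obtain ⟨σ, hσx, hσy, hσ⟩ := exists_perm_apply_eq_apply_eq
    (fun p => tupleType (restrictColoring c π p) (q + 2) (Empty.elim : Empty → A)) hxy hxy'
    (by convert tupleType_comp_eq hx (Empty.elim : Empty → Unit))
    (by convert tupleType_comp_eq hy (Empty.elim : Empty → Unit))
  have hdead {z : A} {p : P} (h : π z ≠ p) : restrictColoring c π p z z = none :=
    restrictColoring_self_eq_none.2 (absurd · h)
  refine tupleType_eq_of_parts hc hπ σ fun p => ?_
  by_cases hpx : π x = p
  · subst hpx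
    rw [hσx]
    rw [pair_eq_extendTuple x y, pair_eq_extendTuple x' y']
    exact tupleType_comp_eq (tupleType_extend_of_succ (hc.restrict π _)
      (tupleType_eq_of_succ hx) (hdead hxy.symm) (hdead hxy'.symm)) ![some (), none]
  by_cases hpy : π y = p
  · subst hpy
    rw [hσy]
    convert tupleType_comp_eq (tupleType_extend_of_succ (hc.restrict π _)
      (tupleType_eq_of_succ hy) (hdead hxy) (hdead hxy')) ![none, some ()]
      using 2 <;> (funext i; fin_cases i <;> rfl)
  · have hpx' : π x' ≠ σ p := fun h => hpx (σ.injective (hσx.trans h))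
    have hpy' : π y' ≠ σ p := fun h => hpy (σ.injective (hσy.trans h))
    convert tupleType_comp_eq (tupleType_extend_of_succ (hc.restrict π _)
      (tupleType_extend_of_succ (hc.restrict π _) (hσ p).symm (hdead hpx) (hdead hpx'))
      (hdead hpy) (hdead hpy')) ![some none, none]
      using 2 <;> (funext i; fin_cases i <;> rfl)

/-- The type of a pair with elements in the same part is determined by its type in this part. -/
theorem tupleType_pair_eq_of_same_part (hc : IsPartialColoring c) (hπ : IsSeparating c π)
    {x y x' y' : A} {p : P} (hx : π x = p) (hy : π y = p) (hx' : π x' = p) (hy' : π y' = p)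
    (h : tupleType (restrictColoring c π p) q ![x, y] =
      tupleType (restrictColoring c π p) q ![x', y']) :
    tupleType c q ![x, y] = tupleType c q ![x', y'] := by
  refine tupleType_eq_of_parts hc hπ (Equiv.refl P) fun r => ?_
  obtain rfl | hr := eq_or_ne r p
  · exact h
  have hdead {z : A} (h : π z = p) : restrictColoring c π r z z = none :=
    restrictColoring_self_eq_none.2 fun h' => absurd (h'.symm.trans h) hr
  have key := (hc.restrict π r).tupleType_extend_congr (q := q) (a := fun _ : Unit => x)
    (b := fun _ : Unit => x') (x := y) (y := y') (fun _ => .inr ⟨hdead hx, hdead hx'⟩)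
    (.inr ⟨hdead hy, hdead hy'⟩)
  rw [pair_eq_extendTuple x y, pair_eq_extendTuple x' y']
  exact tupleType_comp_eq key ![some (), none]

end Composition

/-! ### Recursively separated structures contain no long induced paths -/

/-- The partial structure can be reduced to single elements by `d` rounds of splitting it into parts
such that the colours of pairs with elements in different parts are determined by the elements. -/
def IsRecursivelySeparated {A : Type u} {K : Type} : ℕ → (A → A → Option K) → Prop
  | 0, c => ∀ x y, c x x ≠ none → c y y ≠ none → x = y
  | d + 1, c => ∃ (P : Type u) (π : A → P), IsSeparating c π ∧
      ∀ p, IsRecursivelySeparated d (restrictColoring c π p)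

/-- On the universe of `c`, the relation `E` is determined by the types of quantifier rank `q`. -/
def IsTypeInvariant {A : Type*} {K : Type} (c : A → A → Option K) (q : ℕ) (E : A → A → Prop) : Prop :=
  ∀ x y x' y', c x x ≠ none → c y y ≠ none → c x' x' ≠ none → c y' y' ≠ none →
    tupleType c q ![x, y] = tupleType c q ![x', y'] → (E x y ↔ E x' y')

/-- The elements `s 0, …, s (n - 1)` induce a path in the relation `E`. -/
def IsInducedPath {A : Type*} (E : A → A → Prop) (s : ℕ → A) (n : ℕ) : Prop :=
  ∀ i j, i < n → j < n → (E (s i) (s j) ↔ i + 1 = j ∨ j + 1 = i)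

/-- If `s i` and `s (j + 1)` lay in different parts, their pair would have the type of the adjacent
pair `s i`, `s (i + 1)`, so they would be adjacent too. In an induced path this means `i = j` or `i
= j + 2`, and the residues modulo 3 rule out the latter. -/
theorem not_same_label_of_isInducedPath {A P : Type*} {K : Type} {c : A → A → Option K} {π : A → P}
    (hc : IsPartialColoring c) (hπ : IsSeparating c π) {q : ℕ} {E : A → A → Prop}
    (hE : IsTypeInvariant c q E) {n : ℕ} {s : ℕ → A} (hs : IsInducedPath E s n)
    (hsc : ∀ i < n, c (s i) (s i) ≠ none) {i j : ℕ} (hi : i + 1 < n) (hj : j + 1 < n)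
    (hij : i ≠ j) (hmod : i % 3 = j % 3) (hπi : π (s i) ≠ π (s (i + 1)))
    (hl : tupleType (restrictColoring c π (π (s (i + 1)))) (q + 2) (fun _ : Unit => s (i + 1)) =
      tupleType (restrictColoring c π (π (s (j + 1)))) (q + 2) (fun _ : Unit => s (j + 1))) :
    π (s i) = π (s (j + 1)) := by
  by_contra h
  have := hE _ _ _ _ (hsc i (by omega)) (hsc _ hi) (hsc i (by omega)) (hsc _ hj)
    (tupleType_pair_eq_of_separated hc hπ hπi h rfl hl)
  rw [hs i (i + 1) (by omega) hi, hs i (j + 1) (by omega) hj] at this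
  omega

/-- Inside one part the induction hypothesis applies, because types in the part determine types in
the whole. Crossings between parts are limited by pigeonhole on the finitely many labels. -/
theorem exists_bound_isInducedPath (K : Type) [Finite K] (q d : ℕ) :
    ∃ N : ℕ, ∀ (A : Type u) (c : A → A → Option K), IsPartialColoring c →
      IsRecursivelySeparated d c → ∀ E : A → A → Prop, IsTypeInvariant c q E →
      ∀ (n : ℕ) (s : ℕ → A), (∀ i < n, c (s i) (s i) ≠ none) → IsInducedPath E s n → n ≤ N := by
  classical
  induction d with
  | zero =>
    refine ⟨1, fun A c _ hd E _ n s hsc hs => ?_⟩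
    by_contra! hn
    have h0 := hs 0 0 (by omega) (by omega)
    have h1 := hs 0 1 (by omega) (by omega)
    rw [hd _ _ (hsc 1 hn) (hsc 0 (by omega))] at h1
    rw [h0] at h1
    omega
  | succ d ih =>
    obtain ⟨N, hN⟩ := ih
    let Λ := TupleType (Option K) (q + 2) Unit × TupleType (Option K) (q + 2) Unit × Fin 3
    have : Finite (TupleType (Option K) (q + 2) Unit) := TupleType.finite _ _ _
    have : Fintype Λ := Fintype.ofFinite Λ
    -- There is one crossing in each of `2 * card Λ + 1` disjoint windows of `N + 1` positions,
    -- which forces three crossings with the same label.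
    refine ⟨(2 * Fintype.card Λ + 1) * (N + 1), fun A c hc hd E hE n s hsc hs => ?_⟩
    obtain ⟨P, π, hπ, hP⟩ := hd
    have hcross (a : ℕ) (ha : a + N < n) :
        ∃ i, a ≤ i ∧ i < a + N ∧ π (s i) ≠ π (s (i + 1)) := by
      by_contra! hcon
      have hpart (i : ℕ) (hi : i ≤ N) : π (s (a + i)) = π (s a) := by
        induction i with
        | zero => rfl
        | succ i ih => rw [← ih (by omega), hcon (a + i) (by omega) (by omega), add_assoc]
      have := hN A _ (hc.restrict π (π (s a))) (hP _) E ?_ (N + 1) (fun i => s (a + i)) ?_ ?_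
      · omega
      · intro x y x' y' hx hy hx' hy' h
        simp only [ne_eq, restrictColoring_self_eq_none, Classical.not_imp] at hx hy hx' hy'
        exact hE _ _ _ _ hx.2 hy.2 hx'.2 hy'.2
          (tupleType_pair_eq_of_same_part hc hπ hx.1 hy.1 hx'.1 hy'.1 h)
      · intro i hi
        rw [ne_eq, restrictColoring_self_eq_none, Classical.not_imp]
        exact ⟨hpart i (by omega), hsc _ (by omega)⟩
      · intro i j hi hj
        rw [hs _ _ (by omega) (by omega)]
        omega
    by_contra! hn
    have hblock (t : Fin (2 * Fintype.card Λ + 1)) : t * (N + 1) + N < n := by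
      have : (t + 1) * (N + 1) ≤ (2 * Fintype.card Λ + 1) * (N + 1) :=
        Nat.mul_le_mul_right _ t.2
      rw [add_mul] at this
      omega
    choose i hi1 hi2 hi3 using fun t => hcross _ (hblock t)
    have hin (t) : i t + 1 < n := by
      have := hi2 t
      have := hblock t
      omega
    have hinj : Function.Injective i := by
      intro t t' htt
      have key (t : Fin (2 * Fintype.card Λ + 1)) : (t : ℕ) = i t / (N + 1) :=
        ((Nat.div_eq_iff (by omega)).2 ⟨hi1 t, by have := hi2 t; omega⟩).symm
      exact Fin.ext (by rw [key, key, htt])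
    let label (t : Fin (2 * Fintype.card Λ + 1)) : Λ :=
      (tupleType (restrictColoring c π (π (s (i t)))) (q + 2) (fun _ : Unit => s (i t)),
        tupleType (restrictColoring c π (π (s (i t + 1)))) (q + 2) (fun _ : Unit => s (i t + 1)),
        ⟨i t % 3, Nat.mod_lt _ (by norm_num)⟩)
    obtain ⟨l, -, hl⟩ := Finset.exists_lt_card_fiber_of_mul_lt_card_of_maps_to
      (s := Finset.univ) (t := Finset.univ) (f := label) (n := 2) (fun _ _ => Finset.mem_univ _)
      (by simp only [Finset.card_univ, Fintype.card_fin]; omega)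
    obtain ⟨t₁, t₂, t₃, h₁, h₂, h₃, h₁₂, h₁₃, h₂₃⟩ := Finset.two_lt_card_iff.1 hl
    simp only [Finset.mem_filter, Finset.mem_univ, true_and] at h₁ h₂ h₃
    have key (t t') (ht : label t = l) (ht' : label t' = l) (h : t ≠ t') :
        π (s (i t)) = π (s (i t' + 1)) := by
      have hlab := ht.trans ht'.symm
      exact not_same_label_of_isInducedPath hc hπ hE hs hsc (hin t) (hin t')
        (fun h' => h (hinj h')) (congrArg (fun l : Λ => (l.2.2 : ℕ)) hlab) (hi3 t)
        (congrArg (fun l : Λ => l.2.1) hlab)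
    -- Start of the first crossing, end of the second, start of the third and end of the first:
    -- consecutive ones share a part, so the first crossing does not cross.
    exact hi3 t₁ ((key _ _ h₁ h₂ h₁₂).trans
      ((key _ _ h₃ h₂ h₂₃.symm).symm.trans (key _ _ h₃ h₁ h₁₃.symm)))

/-! ### Trees of bounded depth are recursively separated -/

section Tree

variable {A : Type u} [PartialOrder A] {d : ℕ} {U : Type}

/-- The colours of pairs that encode an ordered structure with chains of at most `d` elements, with
unary predicates given by `col`. -/
noncomputable def treeColoring (hd : ∀ v : A, (Set.Iic v).ncard ≤ d) (col : A → U) (x y : A) :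
    Option ((Fin (d + 1) × U) × (Fin (d + 1) × U) × Prop × Prop) :=
  some ((⟨(Set.Iic x).ncard, Nat.lt_succ_of_le (hd x)⟩, col x),
    (⟨(Set.Iic y).ncard, Nat.lt_succ_of_le (hd y)⟩, col y), x ≤ y, x = y)

theorem eq_of_ncard_Iic_eq [Finite A] {x y : A} (hv : x ≤ y ∨ y ≤ x)
    (h : (Set.Iic x).ncard = (Set.Iic y).ncard) : x = y := by
  rcases hv with hv | hv
  · exact Set.Iic_injective (Set.eq_of_subset_of_ncard_le (Set.Iic_subset_Iic.2 hv) h.ge)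
  · exact (Set.Iic_injective (Set.eq_of_subset_of_ncard_le (Set.Iic_subset_Iic.2 hv) h.le)).symm

/-- The invariant is that all coloured elements have the same ancestors up to level `i`; each round
fixes one more level. -/
theorem isRecursivelySeparated_of_eq_treeColoring [Finite A]
    (hchain : ∀ v x y : A, x ≤ v → y ≤ v → x ≤ y ∨ y ≤ x)
    (hd : ∀ v : A, (Set.Iic v).ncard ≤ d) (col : A → U) (m i : ℕ) (him : i + m = d)
    (c : A → A → Option ((Fin (d + 1) × U) × (Fin (d + 1) × U) × Prop × Prop))
    (hc : ∀ x y, c x x ≠ none → c y y ≠ none → c x y = treeColoring hd col x y ∧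
      {w | w ≤ x ∧ (Set.Iic w).ncard ≤ i} = {w | w ≤ y ∧ (Set.Iic w).ncard ≤ i}) :
    IsRecursivelySeparated m c := by
  induction m generalizing i c with
  | zero =>
    -- Here `i = d` bounds all levels, so each of `x`, `y` is among the ancestors of the other.
    intro x y hx hy
    have h := (hc x y hx hy).2
    simp only [Set.ext_iff, Set.mem_ofPred_eq] at h
    obtain rfl : i = d := him
    exact le_antisymm ((h x).1 ⟨le_rfl, hd x⟩).1 ((h y).2 ⟨le_rfl, hd y⟩).1
  | succ m ih =>
    refine ⟨Set A, fun x => {w | w ≤ x ∧ (Set.Iic w).ncard ≤ i + 1}, ?_, fun p => ?_⟩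
    · refine ⟨fun o o' => o.bind fun k => o'.map fun k' => (k.1, k'.1, k.1.1 ≤ i, False),
        fun x y hx hy hxy => ?_⟩
      rw [(hc x y hx hy).1, (hc x x hx hx).1, (hc y y hy hy).1]
      have hne : x ≠ y := fun h => hxy (by rw [h])
      -- Ancestors up to level `i` are shared by all. If instead `x ≤ y` and `x` is above level `i`
      -- in number, then `x` and `y` have the same ancestors up to level `i + 1` and lie in the same
      -- part.
      have hle : x ≤ y ↔ (Set.Iic x).ncard ≤ i := by
        have h := (hc x y hx hy).2
        simp only [Set.ext_iff, Set.mem_ofPred_eq] at h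
        refine ⟨fun hle => ?_, fun hi => ((h x).1 ⟨le_rfl, hi⟩).1⟩
        by_contra! hi
        refine hxy (Set.ext fun w => ?_)
        refine ⟨fun hw => ⟨hw.1.trans hle, hw.2⟩, fun hw => ⟨?_, hw.2⟩⟩
        rcases hchain y w x hw.1 hle with h' | h'
        · exact h'
        · refine (eq_of_ncard_Iic_eq (.inr h') ?_).le
          have := Set.ncard_le_ncard (Set.Iic_subset_Iic.2 h')
          have := hw.2
          omega
      simp only [treeColoring, Option.bind_some, Option.map_some, hle, hne]
    · refine ih (i + 1) (by omega) _ fun x y hx hy => ?_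
      rw [ne_eq, restrictColoring_self_eq_none, Classical.not_imp] at hx hy
      rw [restrictColoring_of_eq (x := x) (y := y) hx.1 hy.1]
      exact ⟨(hc x y hx.2 hy.2).1, hx.1.trans hy.1.symm⟩

theorem isRecursivelySeparated_treeColoring [Finite A]
    (hchain : ∀ v x y : A, x ≤ v → y ≤ v → x ≤ y ∨ y ≤ x)
    (hd : ∀ v : A, (Set.Iic v).ncard ≤ d) (col : A → U) :
    IsRecursivelySeparated d (treeColoring hd col) := by
  refine isRecursivelySeparated_of_eq_treeColoring hchain hd col d 0 (by omega) _
    fun x y _ _ => ⟨rfl, ?_⟩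
  have hpos (w : A) : ¬ (Set.Iic w).ncard ≤ 0 := by
    rw [Nat.le_zero, Set.ncard_eq_zero]
    exact Set.nonempty_Iic.ne_empty
  simp [hpos]

end Tree

/-! ### Types determine the truth of formulas -/

/-- The threshold `q₀` is a quantifier rank. The map `g` locates the variables in the tuple, which
grows by one entry at each quantifier. -/
theorem realize_iff_of_tupleType_eq {L : FirstOrder.Language.{0, 0}} [L.IsRelational] {K : Type}
    {α : Type} {n : ℕ} (φ : L.BoundedFormula α n) :
    ∃ q₀, ∀ q, q₀ ≤ q → ∀ (A : Type u) [L.Structure A] (c : A → A → K),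
      (∀ x y x' y', c x y = c x' y' → (x = y ↔ x' = y')) →
      (∀ {l : ℕ} (R : L.Relations l) (a b : Fin l → A), (∀ i j, c (a i) (a j) = c (b i) (b j)) →
        (Language.Structure.RelMap R a ↔ Language.Structure.RelMap R b)) →
      ∀ (ι : Type) (a b : ι → A), tupleType c q a = tupleType c q b → ∀ (g : α ⊕ Fin n → ι)
        (v v' : α → A) (xs xs' : Fin n → A), a ∘ g = Sum.elim v xs → b ∘ g = Sum.elim v' xs' →
        (φ.Realize v xs ↔ φ.Realize v' xs') := by
  induction φ with
  | falsum => exact ⟨0, by intros; rfl⟩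
  | equal t₁ t₂ =>
    refine ⟨0, fun q _ A _ c hceq _ ι a b hab g v v' xs xs' ha hb => ?_⟩
    rcases t₁ with i | f
    swap; · exact isEmptyElim f
    rcases t₂ with j | f
    swap; · exact isEmptyElim f
    have : Nonempty A := ⟨a (g i)⟩
    have := hceq _ _ _ _ (color_eq_of_tupleType_eq hab (g i) (g j))
    simpa only [Language.BoundedFormula.Realize, Language.Term.realize, ← ha, ← hb]
  | rel R ts =>
    refine ⟨0, fun q _ A _ c _ hcrel ι a b hab g v v' xs xs' ha hb => ?_⟩
    refine hcrel R _ _ fun i j => ?_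
    cases ti : ts i with
    | func f => exact isEmptyElim f
    | var i' =>
      cases tj : ts j with
      | func f => exact isEmptyElim f
      | var j' =>
        have : Nonempty A := ⟨a (g i')⟩
        simp only [Language.Term.realize, ← ha, ← hb]
        exact color_eq_of_tupleType_eq hab (g i') (g j')
  | imp φ ψ hφ hψ =>
    obtain ⟨q₁, h₁⟩ := hφ
    obtain ⟨q₂, h₂⟩ := hψ
    refine ⟨max q₁ q₂, fun q hq A _ c hceq hcrel ι a b hab g v v' xs xs' ha hb => ?_⟩
    exact imp_congr
      (h₁ q ((le_max_left _ _).trans hq) A c hceq hcrel ι a b hab g v v' xs xs' ha hb)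
      (h₂ q ((le_max_right _ _).trans hq) A c hceq hcrel ι a b hab g v v' xs xs' ha hb)
  | @all n φ hφ =>
    obtain ⟨q₁, h₁⟩ := hφ
    refine ⟨q₁ + 1, fun q hq A _ c hceq hcrel ι a b hab g v v' xs xs' ha hb => ?_⟩
    obtain ⟨q, rfl⟩ : ∃ q', q = q' + 1 := ⟨q - 1, by omega⟩
    rw [tupleType_succ_eq_iff] at hab
    have hext {a : ι → A} {v : α → A} {xs : Fin n → A} (ha : a ∘ g = Sum.elim v xs) (x : A) :
        extendTuple a x ∘ Sum.elim (fun i => some (g (.inl i)))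
          (Fin.snoc (α := fun _ => Option ι) (fun j => some (g (.inr j))) none) =
        Sum.elim v (Fin.snoc xs x) := by
      funext o
      rcases o with o | o
      · exact congrFun ha (.inl o)
      · refine Fin.lastCases ?_ (fun j => ?_) o
        · simp [extendTuple]
        · simpa [extendTuple] using congrFun ha (.inr j)
    have key (x y : A) (hxy : tupleType c q (extendTuple a x) = tupleType c q (extendTuple b y)) :=
      h₁ q (by omega) A c hceq hcrel _ _ _ hxy _ v v' (Fin.snoc xs x) (Fin.snoc xs' y)
        (hext ha x) (hext hb y)
    constructor
    · intro h y
      obtain ⟨x, hx⟩ := hab.2 y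
      exact (key x y hx).1 (h x)
    · intro h x
      obtain ⟨y, hy⟩ := hab.1 x
      exact (key x y hy).2 (h y)

/-! ### Graphs without long paths have bounded treedepth -/

/-- Two vertices are joined by a walk in the set `S` (or are equal). -/
def IsJoinedIn {V : Type u} (G : SimpleGraph V) (S : Set V) : V → V → Prop :=
  Relation.ReflTransGen fun a b => G.Adj a b ∧ a ∈ S ∧ b ∈ S

section IsJoinedIn

variable {V : Type u} {G : SimpleGraph V} {S S' : Set V} {x y : V}

theorem IsJoinedIn.symm (h : IsJoinedIn G S x y) : IsJoinedIn G S y x :=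
  have : Std.Symm (fun a b => G.Adj a b ∧ a ∈ S ∧ b ∈ S) :=
    ⟨fun _ _ h => ⟨h.1.symm, h.2.2, h.2.1⟩⟩
  Relation.ReflTransGen.stdSymm.symm _ _ h

theorem IsJoinedIn.mono (h : IsJoinedIn G S x y) (hS : S ⊆ S') : IsJoinedIn G S' x y :=
  Relation.ReflTransGen.mono (fun _ _ h => ⟨h.1, hS h.2.1, hS h.2.2⟩) _ _ h

/-- If every component of `G[S]` has a vertex from which all paths have at most `k` vertices, then
`S` has a ranking with `k` ranks. -/
theorem exists_ranking (k : ℕ) (S : Set V)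
    (H : ∀ x ∈ S, ∃ r, r ∈ S ∧ IsJoinedIn G S x r ∧ ∀ l : List V, (r :: l).IsChain G.Adj →
      (r :: l).Nodup → (∀ z ∈ r :: l, z ∈ S) → (r :: l).length ≤ k) :
    ∃ h : V → ℕ, (∀ x ∈ S, h x < k) ∧ ∀ x ∈ S, ∀ y ∈ S, h x = h y →
      IsJoinedIn G {z ∈ S | h x ≤ h z} x y → x = y := by
  classical
  induction k generalizing S with
  | zero =>
    have hS (x : V) (hx : x ∈ S) : False := by
      obtain ⟨r, hr, -, hl⟩ := H x hx
      simpa using hl [] (by simp) (by simp) (by simpa)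
    exact ⟨fun _ => 0, fun x hx => (hS x hx).elim, fun x hx => (hS x hx).elim⟩
  | succ k ih =>
    let good (x r : V) : Prop :=
      r ∈ S ∧ IsJoinedIn G S x r ∧ ∀ l : List V, (r :: l).IsChain G.Adj →
        (r :: l).Nodup → (∀ z ∈ r :: l, z ∈ S) → (r :: l).length ≤ k + 1
    -- The choice depends only on the predicate `good x`, which is constant on components, so each
    -- component gets a single root. Roots receive rank 0 and are removed.
    let ρ (x : V) : V := @Classical.epsilon V ⟨x⟩ (good x)
    have hρ (x : V) (hx : x ∈ S) : good x (ρ x) := Classical.epsilon_spec (H x hx)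
    have hρ_eq {x y : V} (h : IsJoinedIn G S x y) : ρ x = ρ y := by
      have : good x = good y := funext fun r => by
        refine propext (and_congr_right fun _ => and_congr_left fun _ => ?_)
        exact ⟨fun h' => h.symm.trans h', fun h' => h.trans h'⟩
      simp only [ρ, this]
    let S₁ : Set V := {x ∈ S | ρ x ≠ x}
    obtain ⟨h, hk, hh⟩ := ih S₁ fun x hx => by
      obtain ⟨hrS, hxr, hlen⟩ := hρ x hx.1
      have hr : ρ (ρ x) = ρ x := (hρ_eq hxr).symm
      have hmem {y : V} (hy : y ∈ S) (hry : IsJoinedIn G S (ρ x) y) (hne : y ≠ ρ x) : y ∈ S₁ :=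
        ⟨hy, by rw [← hρ_eq hry, hr]; exact hne.symm⟩
      -- The vertex `w` follows the last visit of the walk to the root. Prepending the root to a
      -- path from `w` in `S₁` lengthens it by one, so paths from `w` are bounded by `k`.
      have key (y : V) (hy : IsJoinedIn G S (ρ x) y) (hne : y ≠ ρ x) :
          ∃ w, G.Adj (ρ x) w ∧ w ∈ S₁ ∧ IsJoinedIn G S₁ w y := by
        induction hy with
        | refl => exact absurd rfl hne
        | @tail y z hry hyz ihy =>
          have hz : z ∈ S₁ := hmem hyz.2.2 (hry.tail hyz) hne
          by_cases hyr : y = ρ x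
          · exact ⟨z, hyr ▸ hyz.1, hz, .refl⟩
          · obtain ⟨w, hw, hw₁, hwy⟩ := ihy hyr
            exact ⟨w, hw, hw₁, hwy.tail ⟨hyz.1, hmem hyz.2.1 hry hyr, hz⟩⟩
      obtain ⟨w, hw, hw₁, hwx⟩ := key x hxr.symm hx.2.symm
      refine ⟨w, hw₁, hwx.symm, fun l hl hnd hlS => ?_⟩
      have := hlen (w :: l) (List.isChain_cons_cons.2 ⟨hw, hl⟩)
        (List.nodup_cons.2 ⟨fun h' => (hlS _ h').2 hr, hnd⟩)
        (List.forall_mem_cons.2 ⟨hrS, fun z hz => (hlS z hz).1⟩)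
      simpa using this
    refine ⟨fun x => if ρ x = x then 0 else h x + 1, fun x hx => ?_, fun x hx y hy hxy hj => ?_⟩
    · dsimp only
      split_ifs with hx'
      · exact Nat.succ_pos k
      · exact Nat.succ_lt_succ (hk x ⟨hx, hx'⟩)
    · dsimp only at hxy hj
      split_ifs at hxy hj with hx' hy' hy'
      · rw [← hx', ← hy']
        exact hρ_eq (hj.mono fun _ hz => hz.1)
      · refine hh x ⟨hx, hx'⟩ y ⟨hy, hy'⟩ (Nat.succ.inj hxy) (hj.mono fun z hz => ?_)
        obtain ⟨hz, hle⟩ := hz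
        split_ifs at hle with hz'
        · omega
        · exact ⟨⟨hz, hz'⟩, by omega⟩

end IsJoinedIn

/-- A ranking in which equal ranks are separated by smaller ones is an elimination forest in
disguise: `u` is an ancestor of `v` if they are joined through ranks at least `h u`. Ranks are then
injective on the ancestors of a vertex. -/
theorem treedepth_le_of_forall_path_length_le (G : FinGraph.{u}) (k : ℕ)
    (hG : ∀ l : List G.V, l.IsChain G.graph.Adj → l.Nodup → l.length ≤ k) : treedepth G ≤ k := by
  obtain ⟨h, hk, hh⟩ := exists_ranking (G := G.graph) k Set.univ
    fun x _ => ⟨x, trivial, .refl, fun l hl hnd _ => hG _ hl hnd⟩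
  simp only [Set.mem_univ, true_and, forall_const] at hk hh
  let le (u v : G.V) : Prop := h u ≤ h v ∧ IsJoinedIn G.graph {z | h u ≤ h z} u v
  have hmono {u v : G.V} (huv : h u ≤ h v) : {z | h v ≤ h z} ⊆ {z | h u ≤ h z} :=
    fun _ hz => huv.trans hz
  have hle {u u' v : G.V} (hu : le u v) (hu' : le u' v) (huu' : h u ≤ h u') : le u u' :=
    ⟨huu', hu.2.trans (hu'.2.symm.mono (hmono huu'))⟩
  have hanti {u v : G.V} (huv : le u v) (hvu : h v ≤ h u) : u = v :=
    hh u v (huv.1.antisymm hvu) huv.2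
  let F : RootedForest G.V :=
    { order :=
        { le := le
          le_refl := fun u => ⟨le_rfl, .refl⟩
          le_trans := fun u v w huv hvw =>
            ⟨huv.1.trans hvw.1, huv.2.trans (hvw.2.mono (hmono huv.1))⟩
          le_antisymm := fun u v huv hvu => hanti huv hvu.1 }
      isChain_ancestors := fun v u hu u' hu' _ =>
        (le_total (h u) (h u')).imp (hle hu hu') (hle hu' hu) }
  have hF : F.IsEliminationForest G.graph := fun v w hvw =>
    (le_total (h v) (h w)).imp (fun hl => ⟨hl, Relation.ReflTransGen.single ⟨hvw, le_refl (h v), hl⟩⟩)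
      (fun hl => ⟨hl, Relation.ReflTransGen.single ⟨hvw.symm, le_refl (h w), hl⟩⟩)
  have hdepth : F.depth ≤ k := by
    refine ciSup_le' fun v => ?_
    refine (Set.ncard_le_ncard_of_injOn h (t := (Finset.range k : Set ℕ)) (fun w _ => ?_) ?_).trans
      (by rw [Set.ncard_coe_finset, Finset.card_range])
    · simpa using hk w
    · intro w hw w' hw' hww'
      exact hanti (hle hw hw' hww'.le) hww'.ge
  have hle_depth : treedepth G ≤ F.depth := Nat.sInf_le ⟨F, hF, rfl⟩
  exact hle_depth.trans hdepth

/-! ### Graphs whose incidence encodings are transduced from trees of bounded depth -/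

instance (C : Type) : (colorLanguage C).IsRelational := fun _ => inferInstanceAs (IsEmpty Empty)

theorem exists_bound_path_of_transduces {𝒯 : Set RootedTree.{u}} (h𝒯 : IsBoundedDepthTreeClass 𝒯)
    {𝒞 : Set FinGraph.{u}} (h : Transduces (treeEncoding '' 𝒯) (incidenceEncoding '' 𝒞)) :
    ∃ N, ∀ G ∈ 𝒞, ∀ l : List G.V, l.IsChain G.graph.Adj → l.Nodup → l.length ≤ N := by
  obtain ⟨hfin, d, hd⟩ := h𝒯
  obtain ⟨T, hT⟩ := h
  have := T.finite
  let φ := T.formula IncidenceRel.inc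
  obtain ⟨q, hq⟩ := realize_iff_of_tupleType_eq.{u}
    (K := Option ((Fin (d + 1) × Set T.Color) × (Fin (d + 1) × Set T.Color) × Prop × Prop)) φ
  obtain ⟨N, hN⟩ := exists_bound_isInducedPath.{u}
    ((Fin (d + 1) × Set T.Color) × (Fin (d + 1) × Set T.Color) × Prop × Prop) q d
  refine ⟨N, fun G hG l hl hnd => ?_⟩
  obtain ⟨-, ⟨t, ht, rfl⟩, col, S, ⟨iso⟩⟩ := hT _ ⟨G, hG, rfl⟩
  have := hfin t ht
  have hdt (v : t) : (Set.Iic v).ncard ≤ d :=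
    (le_ciSup (Set.finite_range _).bddAbove v).trans (hd t ht)
  let c := treeColoring hdt fun x => {k | x ∈ col k}
  let : Language.order.Structure t := FirstOrder.Language.orderStructure t
  let : (colorLanguage T.Color).Structure t := coloringStructure col
  have hφ (x y x' y' : t) (g : Fin 2 → Fin 2) (hxy : tupleType c q ![x, y] = tupleType c q ![x', y']) :
      φ.Realize (![x, y] ∘ g) ↔ φ.Realize (![x', y'] ∘ g) := by
    refine hq q le_rfl t c ?_ ?_ _ _ _ hxy (Sum.elim g (Fin.elim0)) _ _ _ _ ?_ ?_
    · intro x y x' y' h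
      simp only [c, treeColoring, Option.some.injEq, Prod.mk.injEq] at h
      exact iff_of_eq h.2.2.2
    · intro n R a b hab
      match n, R with
      | 2, .inl .le =>
        have h := hab 0 1
        simp only [c, treeColoring, Option.some.injEq, Prod.mk.injEq] at h
        exact iff_of_eq h.2.2.1
      | 1, .inr (.color k) =>
        have h := hab 0 0
        simp only [c, treeColoring, Option.some.injEq, Prod.mk.injEq] at h
        exact Set.ext_iff.1 h.1.2 k
    · funext i
      rcases i with i | i
      · rfl
      · exact i.elim0
    · funext i
      rcases i with i | i
      · rfl
      · exact i.elim0
  let f (x : G.V ⊕ G.graph.edgeSet) : t := (iso x).1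
  have hinc (x y : G.V ⊕ G.graph.edgeSet) : φ.Realize ![f x, f y] ↔
      ∃ (v : G.V) (e : G.graph.edgeSet), x = Sum.inl v ∧ y = Sum.inr e ∧ v ∈ e.1 := by
    have h := iso.map_rel' IncidenceRel.inc ![x, y]
    refine Iff.trans ?_ h
    refine iff_of_eq (congrArg φ.Realize (funext fun i => ?_))
    fin_cases i <;> rfl
  -- Incidence points from vertices to edges, so it is symmetrised to turn the subdivided path into
  -- an induced path.
  let E (x y : t) : Prop := φ.Realize ![x, y] ∨ φ.Realize (![x, y] ∘ ![1, 0])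
  have hE : IsTypeInvariant c q E := fun x y x' y' _ _ _ _ h =>
    or_congr (hφ x y x' y' id h) (hφ x y x' y' _ h)
  by_contra! hlen
  obtain ⟨x₀⟩ : Nonempty G.V := ⟨l[0]⟩
  let v (i : ℕ) : G.V := l.getD i x₀
  have hv {i : ℕ} (hi : i < l.length) : v i = l[i] := List.getD_eq_getElem _ _ hi
  have hinj {i j : ℕ} (hi : i < l.length) (hj : j < l.length) : v i = v j ↔ i = j := by
    rw [hv hi, hv hj, hnd.getElem_inj_iff]
  have hadj {i : ℕ} (hi : i + 1 < l.length) : G.graph.Adj (v i) (v (i + 1)) := by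
    rw [hv (by omega), hv hi]
    exact List.isChain_iff_getElem.1 hl i hi
  -- Even positions carry the vertices of the path, odd ones the edges between them; `x₀` only fills
  -- positions past the end.
  have hs (i : ℕ) : ∃ x : G.V ⊕ G.graph.edgeSet, i < 2 * l.length - 1 →
      (i % 2 = 0 → x = .inl (v (i / 2))) ∧
      (i % 2 = 1 → ∃ e : G.graph.edgeSet, x = .inr e ∧ e.1 = s(v (i / 2), v (i / 2 + 1))) := by
    by_cases hi : i % 2 = 0
    · exact ⟨.inl (v (i / 2)), fun _ => ⟨fun _ => rfl, fun h => by omega⟩⟩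
    by_cases hi' : i / 2 + 1 < l.length
    · exact ⟨.inr ⟨s(v (i / 2), v (i / 2 + 1)), hadj hi'⟩, fun _ =>
        ⟨fun h => absurd h hi, fun _ => ⟨_, rfl, rfl⟩⟩⟩
    · exact ⟨.inl x₀, fun h => by omega⟩
  choose s hs using hs
  have hsinc {i j : ℕ} (hi : i < 2 * l.length - 1) (hj : j < 2 * l.length - 1) :
      φ.Realize ![f (s i), f (s j)] ↔
        i % 2 = 0 ∧ j % 2 = 1 ∧ (i + 1 = j ∨ j + 1 = i) := by
    rw [hinc]
    rcases Nat.mod_two_eq_zero_or_one i with hi2 | hi2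
    swap
    · obtain ⟨e, he, -⟩ := (hs i hi).2 hi2
      simp [he, hi2]
    rcases Nat.mod_two_eq_zero_or_one j with hj2 | hj2
    · simp [(hs j hj).1 hj2, hj2]
    obtain ⟨e, he, hej⟩ := (hs j hj).2 hj2
    rw [(hs i hi).1 hi2, he]
    have : (∃ (w : G.V) (e' : G.graph.edgeSet), (Sum.inl (v (i / 2)) : G.V ⊕ G.graph.edgeSet) =
        Sum.inl w ∧ (Sum.inr e : G.V ⊕ G.graph.edgeSet) = Sum.inr e' ∧ w ∈ e'.1) ↔
        v (i / 2) ∈ e.1 := by simp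
    refine this.trans ?_
    rw [hej, Sym2.mem_iff, hinj (by omega) (by omega), hinj (by omega) (by omega)]
    omega
  have hpath : IsInducedPath E (fun i => f (s i)) (2 * l.length - 1) := by
    intro i j hi hj
    have hswap : ![f (s i), f (s j)] ∘ ![1, 0] =
        ![f (s j), f (s i)] := by
      funext k
      fin_cases k <;> rfl
    simp only [E]
    rw [hswap, hsinc hi hj, hsinc hj hi]
    omega
  have := hN t c (fun _ h => nomatch h)
    (isRecursivelySeparated_treeColoring
      (fun v x y hx hy => le_total_of_directed hy hx)
      hdt _) E hE _ _ (fun _ _ => Option.some_ne_none _) hpath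
  -- The subdivided path gives `2 * l.length - 1 ≤ N`, against `N < l.length`.
  omega

/-! ### Trees that encode graphs of bounded treedepth -/

section RootedTree

variable {Z : Type u} [PartialOrder Z] [Finite Z]

theorem exists_greatest_of_isChain (hZ : ∀ v x y : Z, x ≤ v → y ≤ v → x ≤ y ∨ y ≤ x) {v : Z}
    {S : Set Z} (hS : S.Nonempty) (hv : ∀ x ∈ S, x ≤ v) : ∃ m, IsGreatest S m := by
  obtain ⟨m, hm⟩ := S.toFinite.exists_maximal hS
  exact ⟨m, hm.1, fun x hx => (hZ v x m (hv x hx) (hv m hm.1)).elim id fun h => hm.2 hx h⟩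

/-- A finite order with a least element in which the sets of lower bounds of an element are chains
is a rooted tree. -/
theorem exists_rootedTree_of_isChain [OrderBot Z]
    (hZ : ∀ v x y : Z, x ≤ v → y ≤ v → x ≤ y ∨ y ≤ x) :
    ∃ T : RootedTree.{u}, Nonempty (T ≃o Z) := by
  classical
  have hinf (a b : Z) : ∃ m, IsGreatest (Set.Iic a ∩ Set.Iic b) m :=
    exists_greatest_of_isChain hZ ⟨⊥, bot_le, bot_le⟩ fun _ hx => hx.1
  choose inf hinf using hinf
  -- The predecessor is the greatest proper ancestor, and the root is its own predecessor.
  have hpred (a : Z) : ∃ m, m ≤ a ∧ (a ≤ m → IsMin a) ∧ ∀ b < a, b ≤ m := by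
    by_cases ha : (Set.Iio a).Nonempty
    · obtain ⟨m, hm⟩ := exists_greatest_of_isChain hZ ha fun _ hx => le_of_lt hx
      exact ⟨m, le_of_lt hm.1, fun h => absurd hm.1 h.not_gt, fun b hb => hm.2 hb⟩
    · refine ⟨a, le_rfl, fun _ b hb => ?_, fun b hb => absurd ⟨b, hb⟩ ha⟩
      by_contra h
      exact ha ⟨b, hb.lt_of_not_ge h⟩
  choose pred hpred using hpred
  let sl : SemilatticeInf Z :=
    { (inferInstance : PartialOrder Z) with
      inf := inf
      inf_le_left := fun a b => (hinf a b).1.1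
      inf_le_right := fun a b => (hinf a b).1.2
      le_inf := fun a b c hab hac => (hinf b c).2 ⟨hab, hac⟩ }
  let po : PredOrder Z :=
    { pred := pred
      pred_le := fun a => (hpred a).1
      min_of_le_pred := fun h => (hpred _).2.1 h
      le_pred_of_lt := fun h => (hpred _).2.2 _ h }
  have : IsPredArchimedean Z := by
    refine ⟨fun {a b} => ?_⟩
    induction b using WellFoundedLT.induction with
    | ind b ih =>
      intro hab
      rcases hab.eq_or_lt with rfl | hlt
      · exact ⟨0, rfl⟩
      · obtain ⟨n, hn⟩ := ih (Order.pred b)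
          (Order.pred_lt_of_not_isMin fun h => (h.not_lt) hlt) (Order.le_pred_of_lt hlt)
        exact ⟨n + 1, hn⟩
  exact ⟨⟨Z⟩, ⟨OrderIso.refl Z⟩⟩

end RootedTree

/-- The vertices and edges of a graph. -/
def IncidenceNode (G : FinGraph.{u}) : Type u := G.V ⊕ G.graph.edgeSet

/-- The edges are below all the ancestors of their endpoints. -/
def RootedForest.incidenceLE {G : FinGraph.{u}} (F : RootedForest G.V) :
    IncidenceNode G → IncidenceNode G → Prop
  | .inl u, .inl v => F.order.le u v
  | .inl u, .inr e => ∃ v ∈ e.1, F.order.le u v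
  | .inr _, .inl _ => False
  | .inr e, .inr e' => e = e'

section IncidenceOrder

variable {G : FinGraph.{u}} (F : RootedForest G.V)

/-- The order in which the edges are added as leaves to a rooted forest on the vertices. -/
@[reducible]
def RootedForest.incidenceOrder : PartialOrder (IncidenceNode G) where
  le := F.incidenceLE
  le_refl x := match x with
    | .inl u => F.order.le_refl u
    | .inr _ => rfl
  le_trans x y z hxy hyz := match x, y, z, hxy, hyz with
    | .inl u, .inl v, .inl w, h, h' => F.order.le_trans u v w h h'
    | .inl u, .inl v, .inr _, h, ⟨w, hw, h'⟩ => ⟨w, hw, F.order.le_trans u v w h h'⟩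
    | .inl _, .inr _, .inr _, h, rfl => h
    | .inr _, .inr _, .inr _, rfl, rfl => rfl
  le_antisymm x y hxy hyx := match x, y, hxy, hyx with
    | .inl u, .inl v, h, h' => congrArg Sum.inl (F.order.le_antisymm u v h h')
    | .inr _, .inr _, rfl, _ => rfl

variable {F}

theorem RootedForest.IsEliminationForest.exists_lowest (hF : F.IsEliminationForest G.graph)
    (e : G.graph.edgeSet) : ∃ w ∈ e.1, ∀ v ∈ e.1, F.order.le v w := by
  obtain ⟨e, he⟩ := e
  induction e using Sym2.ind with
  | _ a b =>
    rcases hF a b he with h | h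
    · refine ⟨b, Sym2.mem_mk_right a b, fun v hv => ?_⟩
      rcases Sym2.mem_iff.1 hv with rfl | rfl
      · exact h
      · exact F.order.le_refl _
    · refine ⟨a, Sym2.mem_mk_left a b, fun v hv => ?_⟩
      rcases Sym2.mem_iff.1 hv with rfl | rfl
      · exact F.order.le_refl _
      · exact h

theorem RootedForest.le_or_le {u v w : G.V} (hu : F.order.le u w) (hv : F.order.le v w) :
    F.order.le u v ∨ F.order.le v u := by
  let := F.order
  exact (F.isChain_ancestors w).total hu hv

theorem RootedForest.IsEliminationForest.incidenceLE_or (hF : F.IsEliminationForest G.graph)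
    {v x y : IncidenceNode G} (hx : F.incidenceLE x v) (hy : F.incidenceLE y v) :
    F.incidenceLE x y ∨ F.incidenceLE y x :=
  match v, x, y, hx, hy with
  | .inl _, .inl _, .inl _, hx, hy => F.le_or_le hx hy
  | .inr e, .inl u, .inl u', ⟨v, hv, hx⟩, ⟨v', hv', hy⟩ => by
    obtain ⟨w, -, hw⟩ := hF.exists_lowest e
    exact F.le_or_le (F.order.le_trans _ _ _ hx (hw v hv)) (F.order.le_trans _ _ _ hy (hw v' hv'))
  | .inr _, .inl _, .inr _, hx, rfl => .inl hx
  | .inr _, .inr _, .inl _, rfl, hy => .inr hy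
  | .inr _, .inr _, .inr _, rfl, rfl => .inl rfl

theorem RootedForest.IsEliminationForest.ncard_incidenceLE (hF : F.IsEliminationForest G.graph)
    (x : IncidenceNode G) : {y | F.incidenceLE y x}.ncard ≤ F.depth + 1 := by
  have := G.finite
  have hdepth (v : G.V) : {w | F.order.le w v}.ncard ≤ F.depth :=
    le_ciSup (f := fun v : G.V => {w | F.order.le w v}.ncard) (Set.finite_range _).bddAbove v
  have : Finite (IncidenceNode G) := inferInstanceAs (Finite (G.V ⊕ G.graph.edgeSet))
  obtain ⟨w, hw⟩ : ∃ w : G.V, {y | F.incidenceLE y x} ⊆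
      insert x ((Sum.inl : G.V → IncidenceNode G) '' {v | F.order.le v w}) := by
    rcases x with u | e
    · refine ⟨u, fun y hy => ?_⟩
      rcases y with v | e
      · exact .inr ⟨v, hy, rfl⟩
      · exact hy.elim
    · obtain ⟨w, -, hw⟩ := hF.exists_lowest e
      refine ⟨w, fun y hy => ?_⟩
      rcases y with v | e'
      · obtain ⟨v', hv', hv⟩ := hy
        exact .inr ⟨v, F.order.le_trans _ _ _ hv (hw v' hv'), rfl⟩
      · exact .inl (congrArg Sum.inr hy)
  calc _ ≤ _ := Set.ncard_le_ncard hw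
    _ ≤ _ := Set.ncard_insert_le _ _
    _ ≤ _ := Nat.add_le_add_right ((Set.ncard_image_le (Set.toFinite _)).trans (hdepth w)) 1

end IncidenceOrder

/-! ### The transduction and its output -/

/-- The formula stating that the variable `i` has the color `k`. -/
def colorFormula {C : Type} {n : ℕ} (k : C) (i : Fin n) :
    (Language.order.sum (colorLanguage C)).Formula (Fin n) :=
  Language.Relations.formula₁ (L := Language.order.sum (colorLanguage C))
    (Sum.inr (ColorRel.color k)) (Language.Term.var i)

/-- The formula stating that the first variable is an ancestor of the second one. -/
def ancestorFormula (C : Type) : (Language.order.sum (colorLanguage C)).Formula (Fin 2) :=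
  Language.Relations.formula₂ (L := Language.order.sum (colorLanguage C))
    (Sum.inl Language.orderRel.le) (Language.Term.var 0) (Language.Term.var 1)

/-- Vertices and edges are selected by colors; the further colors are the levels of the
vertices, and an edge has the colors of its endpoints. The endpoints of an edge are its ancestors
that share a color with it. -/
noncomputable def incidenceTransduction (c : ℕ) : Transduction Language.order incidenceLanguage where
  Color := Bool ⊕ Fin (c + 1)
  formula := fun {n} (r : IncidenceRel n) => match n, r with
    | _, .vertex => colorFormula (.inl true) 0
    | _, .edge => colorFormula (.inl false) 0
    | _, .inc => colorFormula (.inl true) 0 ⊓ (colorFormula (.inl false) 1 ⊓ (ancestorFormula _ ⊓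
        Language.Formula.iSup fun k : Fin (c + 1) =>
          colorFormula (.inr k) 0 ⊓ colorFormula (.inr k) 1))

theorem realize_colorFormula {C : Type} {A : Type u} [PartialOrder A] (col : C → Set A) {n : ℕ}
    (k : C) (i : Fin n) (x : Fin n → A) :
    letI : Language.order.Structure A := FirstOrder.Language.orderStructure A
    letI := coloringStructure col
    (colorFormula k i).Realize x ↔ x i ∈ col k := by
  let : Language.order.Structure A := FirstOrder.Language.orderStructure A
  let := coloringStructure col
  exact Language.Formula.realize_rel₁

theorem realize_ancestorFormula {C : Type} {A : Type u} [PartialOrder A] (col : C → Set A)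
    (x : Fin 2 → A) :
    letI : Language.order.Structure A := FirstOrder.Language.orderStructure A
    letI := coloringStructure col
    (ancestorFormula C).Realize x ↔ x 0 ≤ x 1 := by
  let : Language.order.Structure A := FirstOrder.Language.orderStructure A
  let := coloringStructure col
  exact Language.Formula.realize_rel₂

/-- To the depth of the forest, the leaf for an edge and the new root add one each; hence `c + 2`.
-/
theorem exists_tree_isOutput (G : FinGraph.{u}) {c : ℕ} (hG : treedepth G ≤ c) :
    ∃ T : RootedTree.{u}, Finite T ∧ treeDepth T ≤ c + 2 ∧
      (incidenceTransduction c).IsOutput (treeEncoding T) (incidenceEncoding G) := by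
  obtain ⟨F, hF, hFc⟩ := exists_eliminationForest_depth_eq_treedepth G
  have hfin := G.finite
  have : Finite (IncidenceNode G) := inferInstanceAs (Finite (G.V ⊕ G.graph.edgeSet))
  let := F.incidenceOrder
  have hchain (v x y : WithBot (IncidenceNode G)) (hx : x ≤ v) (hy : y ≤ v) : x ≤ y ∨ y ≤ x := by
    induction x with
    | bot => exact .inl bot_le
    | coe x =>
      induction y with
      | bot => exact .inr bot_le
      | coe y =>
        induction v with
        | bot => exact absurd hx (WithBot.not_coe_le_bot x)
        | coe v =>
          rw [WithBot.coe_le_coe] at hx hy ⊢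
          rw [WithBot.coe_le_coe]
          exact hF.incidenceLE_or hx hy
  have : Finite (WithBot (IncidenceNode G)) := inferInstanceAs (Finite (Option (IncidenceNode G)))
  -- The added bottom element joins the trees of the forest, of which there may be none or several.
  obtain ⟨T, ⟨iso⟩⟩ := exists_rootedTree_of_isChain hchain
  have hT : Finite T := Finite.of_equiv _ iso.symm.toEquiv
  let node (x : IncidenceNode G) : T := iso.symm x
  have hnode_le {x y : IncidenceNode G} : node x ≤ node y ↔ F.incidenceLE x y := by
    simp only [node, OrderIso.le_iff_le, WithBot.coe_le_coe]
    rfl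
  have hnode_inj : Function.Injective node := fun x y h => by
    simpa [node] using h
  refine ⟨T, hT, ciSup_le' fun t => ?_, ?_⟩
  · have hFc' : F.depth ≤ c := hFc.trans_le hG
    obtain ⟨z, rfl⟩ := iso.symm.surjective t
    induction z with
    | bot =>
      have h : Set.Iic (iso.symm ⊥) ⊆ {iso.symm ⊥} := fun s hs => by
        rw [Set.mem_Iic, iso.symm.map_bot, le_bot_iff] at hs
        rw [hs, iso.symm.map_bot, Set.mem_singleton_iff]
      refine (Set.ncard_le_ncard h).trans ?_
      rw [Set.ncard_singleton]
      omega
    | coe x =>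
      have h : Set.Iic (node x) ⊆ insert (iso.symm ⊥) (node '' {y | F.incidenceLE y x}) := by
        intro s hs
        obtain ⟨z, rfl⟩ := iso.symm.surjective s
        induction z with
        | bot => exact .inl rfl
        | coe y => exact .inr ⟨y, hnode_le.1 hs, rfl⟩
      calc _ ≤ _ := Set.ncard_le_ncard h
        _ ≤ _ := Set.ncard_insert_le _ _
        _ ≤ (c + 1) + 1 := Nat.add_le_add_right ((Set.ncard_image_le (Set.toFinite _)).trans
            ((hF.ncard_incidenceLE x).trans (Nat.add_le_add_right hFc' 1))) 1
  -- Levels count the vertex itself and are at most `c`, so they fit into `Fin (c + 1)`.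
  let level (v : G.V) : Fin (c + 1) := ⟨{w | F.order.le w v}.ncard, by
    have := le_ciSup (f := fun v : G.V => {w | F.order.le w v}.ncard)
      (Set.finite_range _).bddAbove v
    have : F.depth = ⨆ v : G.V, {w | F.order.le w v}.ncard := rfl
    omega⟩
  have hlevel {u v : G.V} (huv : F.order.le u v ∨ F.order.le v u) (h : level u = level v) :
      u = v := by
    let := F.order
    exact eq_of_ncard_Iic_eq huv (congrArg Fin.val h)
  let col : Bool ⊕ Fin (c + 1) → Set T
    | .inl true => {t | ∃ v : G.V, t = node (.inl v)}
    | .inl false => {t | ∃ e : G.graph.edgeSet, t = node (.inr e)}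
    | .inr k => {t | (∃ v : G.V, t = node (.inl v) ∧ level v = k) ∨
        ∃ e : G.graph.edgeSet, t = node (.inr e) ∧ ∃ v ∈ e.1, level v = k}
  refine ⟨col, ?_⟩
  let := (incidenceTransduction c).interpret (treeEncoding T) col
  refine ⟨⟨Set.range node, fun f => isEmptyElim f⟩, ⟨⟨Equiv.ofInjective node hnode_inj,
    fun f => isEmptyElim f, ?_⟩⟩⟩
  have hvertex (x : IncidenceNode G) : node x ∈ col (.inl true) ↔ ∃ v : G.V, x = .inl v :=
    exists_congr fun v => hnode_inj.eq_iff
  have hedge (x : IncidenceNode G) :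
      node x ∈ col (.inl false) ↔ ∃ e : G.graph.edgeSet, x = .inr e :=
    exists_congr fun v => hnode_inj.eq_iff
  have hvlevel (k : Fin (c + 1)) (v : G.V) : node (.inl v) ∈ col (.inr k) ↔ level v = k := by
    refine ⟨?_, fun h => .inl ⟨v, rfl, h⟩⟩
    rintro (⟨v', hv', h⟩ | ⟨e, he, -⟩)
    · exact Sum.inl.inj (hnode_inj hv') ▸ h
    · exact nomatch hnode_inj he
  have helevel (k : Fin (c + 1)) (e : G.graph.edgeSet) :
      node (.inr e) ∈ col (.inr k) ↔ ∃ v ∈ e.1, level v = k := by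
    refine ⟨?_, fun h => .inr ⟨e, rfl, h⟩⟩
    rintro (⟨v', hv', h⟩ | ⟨e', he, h⟩)
    · exact nomatch hnode_inj hv'
    · exact Sum.inr.inj (hnode_inj he) ▸ h
  have hinc (x y : IncidenceNode G) : (node x ∈ col (.inl true) ∧ node y ∈ col (.inl false) ∧
      node x ≤ node y ∧ ∃ k : Fin (c + 1), node x ∈ col (.inr k) ∧ node y ∈ col (.inr k)) ↔
      ∃ (v : G.V) (e : G.graph.edgeSet), x = .inl v ∧ y = .inr e ∧ v ∈ e.1 := by
    rw [hvertex, hedge, hnode_le]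
    constructor
    · rintro ⟨⟨v, rfl⟩, ⟨e, rfl⟩, ⟨u, hu, hvu⟩, k, hvk, hek⟩
      rw [hvlevel] at hvk
      rw [helevel] at hek
      obtain ⟨w, hw, hwk⟩ := hek
      -- Both `v` and the endpoint `w` of the same level are ancestors of the lowest endpoint `z`,
      -- hence comparable, hence equal.
      obtain ⟨z, -, hz⟩ := hF.exists_lowest e
      have := hlevel (F.le_or_le (F.order.le_trans _ _ _ hvu (hz u hu)) (hz w hw))
        (hvk.trans hwk.symm)
      exact ⟨v, e, rfl, rfl, this ▸ hw⟩
    · rintro ⟨v, e, rfl, rfl, hve⟩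
      exact ⟨⟨v, rfl⟩, ⟨e, rfl⟩, ⟨v, hve, F.order.le_refl v⟩, level v, (hvlevel _ _).2 rfl,
        (helevel _ _).2 ⟨v, hve, rfl⟩⟩
  intro n r x
  match n, r with
  | _, .vertex => exact (realize_colorFormula col _ _ _).trans (hvertex (x 0))
  | _, .edge => exact (realize_colorFormula col _ _ _).trans (hedge (x 0))
  | _, .inc =>
    let : Language.order.Structure T := FirstOrder.Language.orderStructure T
    let : (colorLanguage (Bool ⊕ Fin (c + 1))).Structure T := coloringStructure col
    have h : Language.Formula.Realize (L := Language.order.sum (colorLanguage (Bool ⊕ Fin (c + 1))))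
        ((incidenceTransduction c).formula IncidenceRel.inc) (fun i => node (x i)) ↔
        node (x 0) ∈ col (.inl true) ∧ node (x 1) ∈ col (.inl false) ∧ node (x 0) ≤ node (x 1) ∧
          ∃ k : Fin (c + 1), node (x 0) ∈ col (.inr k) ∧ node (x 1) ∈ col (.inr k) := by
      refine Language.Formula.realize_inf.trans
        (and_congr (realize_colorFormula col _ _ _) ?_)
      refine Language.Formula.realize_inf.trans
        (and_congr (realize_colorFormula col _ _ _) ?_)
      refine Language.Formula.realize_inf.trans (and_congr (realize_ancestorFormula col _) ?_)
      refine Language.Formula.realize_iSup.trans (exists_congr fun k => ?_)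
      exact Language.Formula.realize_inf.trans
        (and_congr (realize_colorFormula col _ _ _) (realize_colorFormula col _ _ _))
    exact h.trans (hinc (x 0) (x 1))

/-! ### The equivalence -/

theorem mainTheorem8 (𝒞 : Set FinGraph.{u}) :
    HasBoundedTreedepth 𝒞 ↔
      ∃ 𝒯 : Set RootedTree.{u}, IsBoundedDepthTreeClass 𝒯 ∧
        Transduces (treeEncoding '' 𝒯) (incidenceEncoding '' 𝒞) := by
  constructor
  · rintro ⟨c, hc⟩
    refine ⟨{T | Finite T ∧ treeDepth T ≤ c + 2}, ⟨fun T hT => hT.1, c + 2, fun T hT => hT.2⟩,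
      incidenceTransduction c, ?_⟩
    rintro _ ⟨G, hG, rfl⟩
    obtain ⟨T, hT, hTd, hTG⟩ := exists_tree_isOutput G (hc G hG)
    exact ⟨_, ⟨T, ⟨hT, hTd⟩, rfl⟩, hTG⟩
  · rintro ⟨𝒯, h𝒯, h⟩
    obtain ⟨N, hN⟩ := exists_bound_path_of_transduces h𝒯 h
    exact ⟨N, fun G hG => treedepth_le_of_forall_path_length_le G N (hN G hG)⟩
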